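/- For a simple graph $\Gamma$ with vertex set $V(\Gamma)$, let $A(\Gamma)$ be the right-angled Artin group on $\Gamma$, i.e. the group generated by $V(\Gamma)$ subject to the relations $uvu^{-1}v^{-1}=1$ for all adjacent vertices $u,v$ of $\Gamma$. A word in the letters $v^{\pm1}$ ($v\in V(\Gamma)$) is reduced if no shorter word represents the same element of $A(\Gamma)$. The support $\mathrm{supp}(g)$ of $g\in A(\Gamma)$ is the set of vertices $v$ such that $v$ or $v^{-1}$ occurs in a reduced word representing $g$ (this does not depend on the choice of the reduced word). For a homomorphism $\psi\colon A(\Lambda)\to A(\Gamma)$ put $\mathrm{supp}(\psi)=\bigcup_{v\in V(\Lambda)}\mathrm{supp}(\psi(v))$. A full embedding $\Lambda\to\Gamma$ is an injective map $V(\Lambda)\to V(\Gamma)$ that sends adjacent vertices to adjacent vertices and non-adjacent vertices to non-adjacent vertices. Let $P_3^c$ be the complement of the path graph $P_3$ on three vertices. Lemma 4.4. Let $\Gamma$ be a finite simple graph and let $\psi\colon A(P_3^c)\to A(\Gamma)$ be an injective homomorphism. Then there is a full embedding $\iota\colon P_3^c\to\Gamma$ with $\iota(P_3^c)\subset\mathrm{supp}(\psi)$.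 -/

import Mathlib

/-- The defining relators `u v u⁻¹ v⁻¹`, one for each pair of adjacent vertices `u`, `v`. -/
def raagRels {V : Type*} (Γ : SimpleGraph V) : Set (FreeGroup V) :=
  {r | ∃ u v : V, Γ.Adj u v ∧
    r = FreeGroup.of u * FreeGroup.of v * (FreeGroup.of u)⁻¹ * (FreeGroup.of v)⁻¹}

/-- The right-angled Artin group `A(Γ)`: generators are the vertices of `Γ`, and adjacent
vertices commute. -/
abbrev RAAG {V : Type*} (Γ : SimpleGraph V) : Type _ := PresentedGroup (raagRels Γ)

namespace RAAG

/-- The generator of `A(Γ)` given by a vertex. -/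
def of {V : Type*} (Γ : SimpleGraph V) (v : V) : RAAG Γ := PresentedGroup.of v

/-- The element of `A(Γ)` represented by a word. The letter `(v, true)` stands for `v`, and
`(v, false)` for `v⁻¹`. -/
def ofWord {V : Type*} (Γ : SimpleGraph V) (w : List (V × Bool)) : RAAG Γ :=
  PresentedGroup.mk (raagRels Γ) (FreeGroup.mk w)

/-- A word is reduced if every word representing the same element of `A(Γ)` is at least as
long. -/
def IsReducedWord {V : Type*} (Γ : SimpleGraph V) (w : List (V × Bool)) : Prop :=
  ∀ w' : List (V × Bool), ofWord Γ w' = ofWord Γ w → w.length ≤ w'.length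

/-- The set of vertices `v` such that `v` or `v⁻¹` occurs in the word `w`. -/
def wordSupp {V : Type*} (w : List (V × Bool)) : Set V :=
  {v | ∃ ε : Bool, (v, ε) ∈ w}

/-- The support of an element `g` of `A(Γ)`: the support of a reduced word representing `g`. It does
not depend on the reduced word, see `supp_ofWord`. -/
def supp {V : Type*} (Γ : SimpleGraph V) (g : RAAG Γ) : Set V :=
  {v | ∃ w : List (V × Bool), ofWord Γ w = g ∧ IsReducedWord Γ w ∧ v ∈ wordSupp w}

/-- The support of a homomorphism `ψ : A(Λ) → A(Γ)`: the union of the supports of the images of the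
vertices of `Λ`. -/
def homSupp {U V : Type*} {Λ : SimpleGraph U} {Γ : SimpleGraph V} (ψ : RAAG Λ →* RAAG Γ) : Set V :=
  ⋃ u : U, supp Γ (ψ (of Λ u))

open Classical in
/-- Deleting from a word all letters outside `S` respects equality in `A(Γ)`. -/
theorem ofWord_filter_eq {V : Type*} (Γ : SimpleGraph V) (S : Set V) {w w' : List (V × Bool)}
    (h : ofWord Γ w = ofWord Γ w') :
    ofWord Γ (w.filter fun x => decide (x.1 ∈ S)) =
      ofWord Γ (w'.filter fun x => decide (x.1 ∈ S)) := by
  let f : V → RAAG Γ := fun v => if v ∈ S then of Γ v else 1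
  have hf : ∀ r ∈ raagRels Γ, FreeGroup.lift f r = 1 := by
    rintro r ⟨u, v, huv, rfl⟩
    have hc : of Γ u * of Γ v * (of Γ u)⁻¹ * (of Γ v)⁻¹ = 1 :=
      PresentedGroup.one_of_mem ⟨u, v, huv, rfl⟩
    by_cases hu : u ∈ S <;> by_cases hv : v ∈ S <;> simp [f, hu, hv, hc]
  have key : ∀ w : List (V × Bool), PresentedGroup.toGroup hf (ofWord Γ w) =
      ofWord Γ (w.filter fun x => decide (x.1 ∈ S)) := by
    intro w
    induction w with
    | nil => exact map_one (PresentedGroup.toGroup hf)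
    | cons x w ih =>
      obtain ⟨v, ε⟩ := x
      have hcons : ∀ l : List (V × Bool),
          ofWord Γ ((v, ε) :: l) = ofWord Γ [(v, ε)] * ofWord Γ l := fun l => rfl
      have hx : PresentedGroup.toGroup hf (ofWord Γ [(v, ε)]) =
          if v ∈ S then ofWord Γ [(v, ε)] else 1 := by
        have h1 : PresentedGroup.toGroup hf (of Γ v) = f v := PresentedGroup.toGroup.of hf
        cases ε with
        | true => exact h1
        | false =>
          have h2 : ofWord Γ [(v, false)] = (of Γ v)⁻¹ := rfl
          rw [h2, map_inv, h1]
          by_cases hv : v ∈ S <;> simp [f, hv]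
      rw [hcons, map_mul, ih, hx]
      by_cases hv : v ∈ S
      · rw [if_pos hv, List.filter_cons_of_pos (by simpa using hv), ← hcons]
      · rw [if_neg hv, List.filter_cons_of_neg (by simpa using hv), one_mul]
  rw [← key w, ← key w', h]

/-- The support of an element can be read off from any reduced word representing it. -/
theorem supp_ofWord {V : Type*} (Γ : SimpleGraph V) {w : List (V × Bool)}
    (hw : IsReducedWord Γ w) : supp Γ (ofWord Γ w) = wordSupp w := by
  classical
  ext v
  refine ⟨?_, fun hv => ⟨w, rfl, hw, hv⟩⟩
  rintro ⟨w', he, hr, ε, hε⟩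
  have h1 := ofWord_filter_eq Γ (wordSupp w) he
  have h2 : (w.filter fun x => decide (x.1 ∈ wordSupp w)) = w :=
    List.filter_eq_self.2 fun x hx => decide_eq_true ⟨x.2, hx⟩
  rw [h2] at h1
  have h3 := hr _ (h1.trans he.symm)
  have h4 := List.filter_eq_self.1 (List.filter_sublist.eq_of_length_le h3)
  exact of_decide_eq_true (h4 _ hε)

end RAAG

/-! If no induced copy of P₃ᶜ lies in the support `S` of `ψ`, non-adjacency is an equivalence
relation on `S`. Distinct classes commute, so `S` generates a product of free groups, which finitely
many homs to free groups separate (`RAAG.exists_separating_free_homs`). But A(P₃ᶜ) = ℤ² * ℤ is never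
separated this way (`RAAG.exists_mem_ker_of_free_homs`): each hom kills some nontrivial element of
ℤ². A suitable map to the free group on x, y sends all these elements to nontrivial powers of x, and
iterated commutators of their conjugates then give a common kernel element with nontrivial image. -/

open commutatorElement

/-- In a free group, two commuting elements satisfy a nontrivial relation `a ^ p * c ^ q = 1`. -/
theorem IsFreeGroup.exists_zpow_mul_zpow_eq_one {G : Type*} [Group G] [IsFreeGroup G] {a c : G}
    (hac : Commute a c) : ∃ p q : ℤ, (p ≠ 0 ∨ q ≠ 0) ∧ a ^ p * c ^ q = 1 := by
  classical
  let H : Subgroup G := Subgroup.closure {a, c}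
  have hcomm : ∀ x ∈ ({a, c} : Set G), ∀ y ∈ ({a, c} : Set G), x * y = y * x := by
    rintro x (rfl | rfl) y (rfl | rfl)
    exacts [rfl, hac, hac.symm, rfl]
  have hH : IsMulCommutative H := Subgroup.isMulCommutative_closure hcomm
  -- The subgroup `H` is free by Nielsen–Schreier. Two distinct basis elements could be sent to
  -- non-commuting transpositions of `Fin 3`, so the abelian group `H` has rank at most one.
  have hsub : Subsingleton (IsFreeGroup.Generators H) := by
    refine ⟨fun i j => ?_⟩
    by_contra hij
    let f : H →* Equiv.Perm (Fin 3) := IsFreeGroup.lift fun k =>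
      if k = i then Equiv.swap 0 1 else Equiv.swap 1 2
    have h1 : f (IsFreeGroup.of i * IsFreeGroup.of j) = f (IsFreeGroup.of j * IsFreeGroup.of i) :=
      congrArg f (hH.is_comm.comm _ _)
    simp only [f, map_mul, IsFreeGroup.lift_of, if_true, if_neg (Ne.symm hij)] at h1
    exact absurd h1 (by decide)
  have hcyc : IsCyclic (FreeGroup (IsFreeGroup.Generators H)) := by
    rcases isEmpty_or_nonempty (IsFreeGroup.Generators H) with he | ⟨⟨i⟩⟩
    · infer_instance
    · have : Unique (IsFreeGroup.Generators H) := ⟨⟨i⟩, fun j => Subsingleton.elim j i⟩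
      infer_instance
  have hcycH : IsCyclic H := (IsFreeGroup.mulEquiv H).isCyclic.1 hcyc
  obtain ⟨g, hg⟩ := hcycH.exists_generator
  obtain ⟨m, hm⟩ := Subgroup.mem_zpowers_iff.1
    (hg ⟨a, Subgroup.subset_closure (Set.mem_insert a {c})⟩)
  obtain ⟨n, hn⟩ := Subgroup.mem_zpowers_iff.1
    (hg ⟨c, Subgroup.subset_closure (Set.mem_insert_of_mem a rfl)⟩)
  have hm' : (g : G) ^ m = a := congrArg Subtype.val hm
  have hn' : (g : G) ^ n = c := congrArg Subtype.val hn
  by_cases h0 : n = 0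
  · subst h0
    exact ⟨0, 1, Or.inr one_ne_zero, by rw [← hn']; simp⟩
  · refine ⟨n, -m, Or.inl h0, ?_⟩
    rw [← hm', ← hn', ← zpow_mul, ← zpow_mul, ← zpow_add]
    exact (congrArg _ (by ring)).trans (zpow_zero _)

namespace FreeGroup

/-- Exponent sums give `A = B`. Letting x act on ℚ by t ↦ t + 1 and y by t ↦ 2t, evaluation at 0
gives `A = 2 * B`. -/
theorem eq_zero_of_of_zpow_eq_conj {A B : ℤ}
    (h : of true ^ A = of false * of true ^ B * (of false)⁻¹) : A = 0 := by
  have h1 := congrArg (FreeGroup.lift fun _ : Bool => Multiplicative.ofAdd (1 : ℤ)) h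
  let f : FreeGroup Bool →* Equiv.Perm ℚ := FreeGroup.lift fun b =>
    if b then Equiv.addRight 1 else Equiv.mulRight₀ 2 two_ne_zero
  have h2 := congrArg (fun g => f g 0) h
  have e1 : A = B := by
    have := congrArg Multiplicative.toAdd h1
    simpa using this
  have e2 : (A : ℚ) = B * 2 := by
    simpa [f, Equiv.Perm.mul_apply] using h2
  have e3 : A = B * 2 := by exact_mod_cast e2
  omega

theorem of_zpow_ne_one {m : ℤ} (hm : m ≠ 0) : (of true : FreeGroup Bool) ^ m ≠ 1 := by
  intro h
  refine hm (eq_zero_of_of_zpow_eq_conj (B := 0) ?_)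
  simp [h]

/-- A nontrivial element of the free group on `x`, `y` does not commute with both `x ^ m` and
`y * x ^ m * y⁻¹`. -/
theorem not_commute_conj {h : FreeGroup Bool} (hh : h ≠ 1) {m : ℤ} (hm : m ≠ 0)
    (h1 : Commute h (of true ^ m)) :
    ¬ Commute h (of false * of true ^ m * (of false)⁻¹) := by
  intro h2
  obtain ⟨p, q, hpq, e⟩ := IsFreeGroup.exists_zpow_mul_zpow_eq_one h1
  obtain ⟨p', q', hpq', e'⟩ := IsFreeGroup.exists_zpow_mul_zpow_eq_one h2
  rw [conj_zpow] at e'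
  rw [← zpow_mul] at e e'
  have hq : q ≠ 0 := by
    rintro rfl
    have hp : p ≠ 0 := by simpa using hpq
    exact hh ((IsMulTorsionFree.zpow_eq_one_iff_left hp).1 (by simpa using e))
  have hp' : p' ≠ 0 := by
    rintro rfl
    have hq' : q' ≠ 0 := by simpa using hpq'
    refine of_zpow_ne_one (mul_ne_zero hm hq') ?_
    simpa using e'
  have e1 : of true ^ (m * q) = h ^ (-p) := by
    rw [zpow_neg]; exact (inv_eq_of_mul_eq_one_right e).symm
  have e2 : of false * of true ^ (m * q') * (of false)⁻¹ = h ^ (-p') := by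
    rw [zpow_neg]; exact (inv_eq_of_mul_eq_one_right e').symm
  -- Both sides equal `h ^ (-(p * p'))`.
  have key : of true ^ (m * q * p') = of false * of true ^ (m * q' * p) * (of false)⁻¹ := by
    rw [zpow_mul, e1, zpow_mul (of true) (m * q') p, ← conj_zpow, e2, ← zpow_mul, ← zpow_mul]
    congr 1
    ring
  exact mul_ne_zero (mul_ne_zero hm hq) hp' (eq_zero_of_of_zpow_eq_conj key)

end FreeGroup

/-- Homomorphisms which each kill an element that `θ` sends to a nontrivial power of `x` have a
common element in their kernels that `θ` does not kill. -/
theorem exists_mem_ker_of_zpow {G : Type*} [Group G] {Q : Type*} [Finite Q] {F : Q → Type*}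
    [∀ i, Group (F i)] (f : ∀ i, G →* F i) (θ : G →* FreeGroup Bool)
    (hθ : Function.Surjective θ)
    (hf : ∀ i, ∃ g : G, f i g = 1 ∧ ∃ m : ℤ, m ≠ 0 ∧ θ g = FreeGroup.of true ^ m) :
    ∃ g : G, (∀ i, f i g = 1) ∧ g ≠ 1 := by
  classical
  have := Fintype.ofFinite Q
  have main : ∀ T : Finset Q, ∃ g : G, (∀ i ∈ T, f i g = 1) ∧ θ g ≠ 1 := by
    intro T
    induction T using Finset.induction_on with
    | empty =>
      obtain ⟨a, ha⟩ := hθ (FreeGroup.of true)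
      exact ⟨a, by simp, ha ▸ FreeGroup.of_ne_one true⟩
    | insert j T _ ih =>
      obtain ⟨g, hg, hg1⟩ := ih
      obtain ⟨n, hn, m, hm, hnm⟩ := hf j
      obtain ⟨b, hb⟩ := hθ (FreeGroup.of false)
      have hker : ∀ n' : G, f j n' = 1 → ∀ i ∈ insert j T, f i ⁅g, n'⁆ = 1 := by
        intro n' hn' i hi
        rw [map_commutatorElement]
        rcases Finset.mem_insert.1 hi with rfl | hi
        · rw [hn', commutatorElement_one_right]
        · rw [hg i hi, commutatorElement_one_left]
      -- A commutator with `n` or a conjugate of it is killed by `f j` and by every hom that kills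
      -- `g`. By `not_commute_conj`, one of the two choices keeps its image under `θ` nontrivial.
      by_cases hc : Commute (θ g) (FreeGroup.of true ^ m)
      · refine ⟨⁅g, b * n * b⁻¹⁆, hker _ (by simp [hn]), ?_⟩
        rw [map_commutatorElement, Ne, commutatorElement_eq_one_iff_commute]
        simpa [hnm, hb] using FreeGroup.not_commute_conj hg1 hm hc
      · refine ⟨⁅g, n⁆, hker _ hn, ?_⟩
        rwa [map_commutatorElement, Ne, commutatorElement_eq_one_iff_commute, hnm]
  obtain ⟨g, hg, hg1⟩ := main Finset.univ
  exact ⟨g, fun i => hg i (Finset.mem_univ i), fun h => hg1 (by rw [h, map_one])⟩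

/-- A single integer `K` makes finitely many nonzero linear forms `p + K * q` nonzero. -/
theorem exists_int_forall_add_mul_ne_zero {Q : Type*} [Finite Q] (p q : Q → ℤ)
    (h : ∀ i, p i ≠ 0 ∨ q i ≠ 0) : ∃ K : ℤ, ∀ i, p i + K * q i ≠ 0 := by
  -- Rounding in the integer quotient is harmless: a root `K` with `q i ≠ 0` is an exact quotient.
  obtain ⟨K, hK⟩ := (Set.finite_range fun i => -p i / q i).infinite_compl.nonempty
  refine ⟨K, fun i hi => ?_⟩
  by_cases hq : q i = 0
  · exact (h i).resolve_right (not_not.2 hq) (by simpa [hq] using hi)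
  · refine hK ⟨i, Int.ediv_eq_of_eq_mul_left hq ?_⟩
    linarith

namespace RAAG

variable {V : Type*} {Γ : SimpleGraph V}

theorem lift_eq_one_of_mem_raagRels {G : Type*} [Group G] (f : V → G)
    (hf : ∀ u v, Γ.Adj u v → Commute (f u) (f v)) :
    ∀ r ∈ raagRels Γ, FreeGroup.lift f r = 1 := by
  rintro r ⟨u, v, huv, rfl⟩
  have := commutatorElement_eq_one_iff_commute.2 (hf u v huv)
  simpa [commutatorElement_def] using this

/-- The homomorphism from `A(Γ)` given by images of the vertices that commute for adjacent
vertices. -/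
def lift {G : Type*} [Group G] (f : V → G)
    (hf : ∀ u v, Γ.Adj u v → Commute (f u) (f v)) : RAAG Γ →* G :=
  PresentedGroup.toGroup (lift_eq_one_of_mem_raagRels f hf)

@[simp]
theorem lift_of {G : Type*} [Group G] (f : V → G)
    (hf : ∀ u v, Γ.Adj u v → Commute (f u) (f v)) (v : V) : lift f hf (of Γ v) = f v :=
  PresentedGroup.toGroup.of _

theorem commute_of {u v : V} (h : Γ.Adj u v) : Commute (of Γ u) (of Γ v) := by
  rw [← commutatorElement_eq_one_iff_commute, commutatorElement_def]
  exact PresentedGroup.one_of_mem ⟨u, v, h, rfl⟩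

theorem ofWord_mem_closure {S : Set V} (w : List (V × Bool)) (hw : wordSupp w ⊆ S) :
    ofWord Γ w ∈ Subgroup.closure (of Γ '' S) := by
  induction w with
  | nil => exact one_mem _
  | cons x w ih =>
    obtain ⟨v, ε⟩ := x
    have hv : of Γ v ∈ Subgroup.closure (of Γ '' S) :=
      Subgroup.subset_closure ⟨v, hw ⟨ε, List.mem_cons_self⟩, rfl⟩
    have hvw : ofWord Γ ((v, ε) :: w) = ofWord Γ [(v, ε)] * ofWord Γ w := rfl
    rw [hvw]
    refine mul_mem ?_ (ih fun u hu => hw (hu.imp fun _ => List.mem_cons_of_mem _))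
    cases ε with
    | true => exact hv
    | false => exact inv_mem hv

theorem exists_isReducedWord (g : RAAG Γ) : ∃ w, ofWord Γ w = g ∧ IsReducedWord Γ w := by
  have hne : {w | ofWord Γ w = g}.Nonempty := by
    obtain ⟨x, rfl⟩ := PresentedGroup.mk_surjective (raagRels Γ) g
    obtain ⟨w, rfl⟩ := Quot.exists_rep x
    exact ⟨w, rfl⟩
  have hmin := Function.argminOn_mem List.length {w | ofWord Γ w = g} hne
  refine ⟨_, hmin, fun w' hw' => ?_⟩
  exact Function.argminOn_le List.length {w | ofWord Γ w = g} (hw'.trans hmin)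

theorem mem_closure_supp (g : RAAG Γ) : g ∈ Subgroup.closure (of Γ '' supp Γ g) := by
  obtain ⟨w, rfl, hw⟩ := exists_isReducedWord g
  exact ofWord_mem_closure w (supp_ofWord Γ hw).ge

theorem map_mem_closure_homSupp {U : Type*} {Λ : SimpleGraph U} (ψ : RAAG Λ →* RAAG Γ)
    (g : RAAG Λ) : ψ g ∈ Subgroup.closure (of Γ '' homSupp ψ) := by
  have hg : g ∈ Subgroup.closure (Set.range (of Λ)) := by
    have := PresentedGroup.closure_range_of (raagRels Λ)
    exact this.ge (Subgroup.mem_top g)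
  have hle : Subgroup.closure (Set.range (of Λ)) ≤
      (Subgroup.closure (of Γ '' homSupp ψ)).comap ψ := by
    rw [Subgroup.closure_le]
    rintro _ ⟨u, rfl⟩
    exact Subgroup.closure_mono (Set.image_mono (Set.subset_iUnion _ u)) (mem_closure_supp _)
  exact hle hg

/-- If non-adjacency is transitive on `S`, then finitely many homomorphisms to free groups jointly
separate the elements of the subgroup generated by `S`. -/
theorem exists_separating_free_homs.{u} {V : Type u} {Γ : SimpleGraph V} [Finite V] (S : Set V)
    (hS : ∀ u ∈ S, ∀ v ∈ S, ∀ w ∈ S, ¬ Γ.Adj u v → ¬ Γ.Adj v w → ¬ Γ.Adj u w) :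
    ∃ (Q : Type u) (_ : Finite Q) (f : Q → RAAG Γ →* FreeGroup S),
      ∀ g ∈ Subgroup.closure (of Γ '' S), (∀ i, f i g = 1) → g = 1 := by
  classical
  let s : Setoid S :=
    { r := fun u v => ¬ Γ.Adj u v
      iseqv :=
        { refl := fun u => Γ.irrefl
          symm := fun h h' => h h'.symm
          trans := fun {u v w} => hS u u.2 v v.2 w w.2 } }
  have := Fintype.ofFinite (Quotient s)
  let f (i : Quotient s) : RAAG Γ →* FreeGroup S :=
    lift (fun v => if h : ∃ hv : v ∈ S, (⟦⟨v, hv⟩⟧ : Quotient s) = i then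
      FreeGroup.of ⟨v, h.1⟩ else 1) (by
        intro u v huv
        by_cases hu : ∃ hu : u ∈ S, (⟦⟨u, hu⟩⟧ : Quotient s) = i
        · by_cases hv : ∃ hv : v ∈ S, (⟦⟨v, hv⟩⟧ : Quotient s) = i
          · obtain ⟨hu, rfl⟩ := hu
            obtain ⟨hv, h⟩ := hv
            exact absurd huv.symm (Quotient.exact h)
          · rw [dif_neg hv]
            exact Commute.one_right _
        · rw [dif_neg hu]
          exact Commute.one_left _)
  -- Letters outside class `i` must die here, so that the images for distinct classes commute.
  let φ (i : Quotient s) : FreeGroup S →* RAAG Γ :=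
    FreeGroup.lift fun v => if ⟦v⟧ = i then of Γ v else 1
  have hφ : Pairwise fun i j => ∀ x y, Commute (φ i x) (φ j y) := by
    intro i j hij x y
    have hgen : ∀ u v : S, Commute (φ i (FreeGroup.of u)) (φ j (FreeGroup.of v)) := by
      intro u v
      simp only [φ, FreeGroup.lift_apply_of]
      split_ifs with hu hv
      · refine commute_of (not_not.1 fun h => hij ?_)
        rw [← hu, ← hv]
        exact Quotient.sound h
      all_goals simp
    induction x using FreeGroup.induction_on with
    | C1 => rw [map_one]; exact Commute.one_left _
    | inv_of u h => rw [map_inv]; exact h.inv_left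
    | mul a b ha hb => rw [map_mul]; exact ha.mul_left hb
    | of u =>
      induction y using FreeGroup.induction_on with
      | C1 => rw [map_one]; exact Commute.one_right _
      | inv_of u h => rw [map_inv]; exact h.inv_right
      | mul a b ha hb => rw [map_mul]; exact ha.mul_right hb
      | of v => exact hgen u v
  -- This map factors through all the `f i` together and fixes each generator in `S`, which forces
  -- the separation.
  let ρ : RAAG Γ →* RAAG Γ := (MonoidHom.noncommPiCoprod φ hφ).comp (MonoidHom.pi f)
  have hρ : ∀ g ∈ Subgroup.closure (of Γ '' S), ρ g = g := by
    have hle : Subgroup.closure (of Γ '' S) ≤ ρ.eqLocus (MonoidHom.id _) := by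
      rw [Subgroup.closure_le]
      rintro _ ⟨v, hv, rfl⟩
      have hsingle : MonoidHom.pi f (of Γ v) =
          Pi.mulSingle (⟦⟨v, hv⟩⟧ : Quotient s) (FreeGroup.of ⟨v, hv⟩) := by
        funext i
        simp only [MonoidHom.pi_apply, f, lift_of]
        by_cases h : (⟦⟨v, hv⟩⟧ : Quotient s) = i
        · subst h
          rw [dif_pos ⟨hv, rfl⟩, Pi.mulSingle_eq_same]
        · rw [dif_neg fun h' => h h'.2, Pi.mulSingle_eq_of_ne' h]
      change MonoidHom.noncommPiCoprod φ hφ (MonoidHom.pi f (of Γ v)) = of Γ v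
      rw [hsingle, MonoidHom.noncommPiCoprod_mulSingle]
      simp [φ]
    exact fun g hg => hle hg
  refine ⟨Quotient s, inferInstance, f, fun g hg h => ?_⟩
  rw [← hρ g hg]
  change MonoidHom.noncommPiCoprod φ hφ (MonoidHom.pi f g) = 1
  rw [show MonoidHom.pi f g = 1 from funext h, map_one]

theorem compl_pathGraph_three_adj {i j : Fin 3} (h : (SimpleGraph.pathGraph 3)ᶜ.Adj i j) :
    i = 0 ∧ j = 2 ∨ i = 2 ∧ j = 0 := by
  revert i j
  simp only [SimpleGraph.compl_adj, SimpleGraph.pathGraph_adj]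
  decide

theorem compl_pathGraph_three_adj_zero_two : (SimpleGraph.pathGraph 3)ᶜ.Adj 0 2 := by
  simp [SimpleGraph.compl_adj, SimpleGraph.pathGraph_adj]

/-- Finitely many homomorphisms from `A(P₃ᶜ)` to free groups have a common nontrivial element in
their kernels. -/
theorem exists_mem_ker_of_free_homs {Q : Type*} [Finite Q] {F : Q → Type*} [∀ i, Group (F i)]
    [∀ i, IsFreeGroup (F i)] (f : ∀ i, RAAG (SimpleGraph.pathGraph 3)ᶜ →* F i) :
    ∃ g, (∀ i, f i g = 1) ∧ g ≠ 1 := by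
  let Λ := (SimpleGraph.pathGraph 3)ᶜ
  have hac : Commute (of Λ 0) (of Λ 2) := commute_of compl_pathGraph_three_adj_zero_two
  choose p q hpq h using fun i => IsFreeGroup.exists_zpow_mul_zpow_eq_one (hac.map (f i))
  obtain ⟨K, hK⟩ := exists_int_forall_add_mul_ne_zero p q hpq
  let x : FreeGroup Bool := FreeGroup.of true
  let θ : RAAG Λ →* FreeGroup Bool := lift ![x, FreeGroup.of false, x ^ K] (by
    intro u v huv
    rcases compl_pathGraph_three_adj huv with ⟨rfl, rfl⟩ | ⟨rfl, rfl⟩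
    · exact (Commute.refl x).zpow_right K
    · exact (Commute.refl x).zpow_left K)
  have h0 : θ (of Λ 0) = x := lift_of _ _ _
  have h1 : θ (of Λ 1) = FreeGroup.of false := lift_of _ _ _
  have h2 : θ (of Λ 2) = x ^ K := lift_of _ _ _
  refine exists_mem_ker_of_zpow f θ ?_ fun i =>
    ⟨of Λ 0 ^ p i * of Λ 2 ^ q i, by simpa using h i, p i + K * q i, hK i, ?_⟩
  · rw [← MonoidHom.range_eq_top, eq_top_iff, ← FreeGroup.closure_range_of, Subgroup.closure_le]
    rintro _ ⟨b, rfl⟩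
    cases b
    exacts [⟨_, h1⟩, ⟨_, h0⟩]
  · rw [map_mul, map_zpow, map_zpow, h0, h2, ← zpow_mul, ← zpow_add]

/-- An edge `u w` and a vertex `v` adjacent to neither of its ends span a copy of `P₃ᶜ`. -/
theorem exists_embedding_compl_pathGraph_three {S : Set V} {u v w : V} (hu : u ∈ S) (hv : v ∈ S)
    (hw : w ∈ S) (huv : ¬ Γ.Adj u v) (hvw : ¬ Γ.Adj v w) (huw : Γ.Adj u w) :
    ∃ ι : (SimpleGraph.pathGraph 3)ᶜ ↪g Γ, Set.range ι ⊆ S := by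
  have h1 : u ≠ v := by rintro rfl; exact hvw huw
  have h2 : v ≠ w := by rintro rfl; exact huv huw
  have hinj : Function.Injective ![u, v, w] := by
    intro i j
    fin_cases i <;> fin_cases j <;> simp [h1, h2, huw.ne, h1.symm, h2.symm, huw.ne']
  refine ⟨⟨⟨![u, v, w], hinj⟩, ?_⟩, ?_⟩
  · intro i j
    fin_cases i <;> fin_cases j <;>
      simp [SimpleGraph.compl_adj, SimpleGraph.pathGraph_adj, huv, hvw, huw, huw.symm,
        Γ.adj_comm v u, Γ.adj_comm w v]
  · rintro _ ⟨i, rfl⟩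
    fin_cases i
    exacts [hu, hv, hw]

end RAAG

theorem lemma4p4 {V : Type*} [Finite V] (Γ : SimpleGraph V)
    (ψ : RAAG (SimpleGraph.pathGraph 3)ᶜ →* RAAG Γ) (hψ : Function.Injective ψ) :
    ∃ ι : (SimpleGraph.pathGraph 3)ᶜ ↪g Γ, Set.range ι ⊆ RAAG.homSupp ψ := by
  by_contra hι
  obtain ⟨Q, _, f, hf⟩ := RAAG.exists_separating_free_homs (Γ := Γ) (RAAG.homSupp ψ)
    fun u hu v hv w hw huv hvw huw =>
      hι (RAAG.exists_embedding_compl_pathGraph_three hu hv hw huv hvw huw)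
  obtain ⟨g, hg, hg1⟩ := RAAG.exists_mem_ker_of_free_homs fun i => (f i).comp ψ
  refine hg1 (hψ ?_)
  rw [map_one]
  exact hf _ (RAAG.map_mem_closure_homSupp ψ g) hg
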